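/- Let $X$ be a connected CW-complex with finite $1$-skeleton, let $x_0\in X$, and let $G=\pi_1(X,x_0)$. Let $\chi\colon G\twoheadrightarrow A$ be an epimorphism onto a finite abelian group $A$, and let $p\colon (X^{\chi},y_0)\to (X,x_0)$ be the regular cover defined by $\chi$, i.e. a connected covering space with $p_\sharp(\pi_1(X^{\chi},y_0))=\ker\chi$. Let $k$ be an algebraically closed field whose characteristic does not divide $|A|$. For a character $\rho\in\widehat G=\operatorname{Hom}(G,k^*)$ let $k_\rho$ be the associated rank $1$ local system on $X$, and for $q\ge 0$, $s\ge 1$ let $$\mathcal V^q_s(X,k)=\{\rho\in \operatorname{Hom}(G,k^*) \mid \dim_k H_q(X,k_\rho)\ge s\}.$$ Let $\widehat\chi\colon \operatorname{Hom}(A,k^*)\to\operatorname{Hom}(G,k^*)$, $\iota\mapsto\iota\circ\chi$, be the induced map of character groups. Then, for every $q\ge 0$, $$\dim_k H_q(X^{\chi},k)=\sum_{s\ge 1}\bigl|\operatorname{im}(\widehat\chi)\cap\mathcal V^q_s(X,k)\bigr|,$$ where both sides are elements of $\{0,1,2,\dots\}\cup\{\infty\}$ (one side is infinite if and only if the other is).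 -/

import Mathlib

open CategoryTheory CategoryTheory.Limits

noncomputable section

namespace AbelianCover

universe u v w

/-! ### Singular chains with local coefficients -/

section Chains

/-- The initial vertex of the topological standard simplex. -/
def vertexZero (n : SimplexCategory) : SimplexCategory.toTop.{u}.obj n :=
  ULift.up (stdSimplex.vertex (S := ℝ) (X := Fin (n.len + 1)) 0)

/-- Standard simplices are simply connected, being homeomorphic to convex sets. -/
instance simplex_simplyConnected (n : SimplexCategory) :
    SimplyConnectedSpace (SimplexCategory.toTop.{u}.obj n) := by
  have hc : ContractibleSpace (stdSimplex ℝ (Fin (n.len + 1))) :=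
    (convex_stdSimplex ℝ (Fin (n.len + 1))).contractibleSpace
      ⟨_, (stdSimplex.vertex (S := ℝ) (X := Fin (n.len + 1)) 0).2⟩
  have : ContractibleSpace (ULift.{u} (stdSimplex ℝ (Fin (n.len + 1)))) :=
    (Homeomorph.ulift.{u} (X := stdSimplex ℝ (Fin (n.len + 1)))).contractibleSpace
  exact (inferInstance : SimplyConnectedSpace (ULift.{u} (stdSimplex ℝ (Fin (n.len + 1)))))

instance simplex_hom_subsingleton (n : SimplexCategory)
    (v w : FundamentalGroupoid (SimplexCategory.toTop.{u}.obj n)) : Subsingleton (v ⟶ w) :=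
  inferInstanceAs (Subsingleton (Path.Homotopic.Quotient v.as w.as))

/-- The homotopy class of paths between two points of a standard simplex; it is unique. -/
def simplexPath (n : SimplexCategory) (v w : SimplexCategory.toTop.{u}.obj n) :
    FundamentalGroupoid.mk v ⟶ FundamentalGroupoid.mk w :=
  Path.Homotopic.Quotient.mk (PathConnectedSpace.somePath v w)

variable {C : Type w} [Category.{v} C] {X : Type u} [TopologicalSpace X]

/-- Singular simplices of `X`, as the simplices of the singular simplicial set. -/
abbrev Simp (X : Type u) [TopologicalSpace X] (n : SimplexCategoryᵒᵖ) : Type u :=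
  (TopCat.toSSet.obj (TopCat.of X)).obj n

/-- The continuous map underlying a singular simplex. -/
def simpMap {n : SimplexCategoryᵒᵖ} (σ : Simp X n) :
    C(SimplexCategory.toTop.{u}.obj n.unop, X) :=
  σ.down.hom

/-- The stalk of a local system `L` at the initial vertex of a singular simplex. -/
abbrev stalk (L : FundamentalGroupoid X ⥤ C) {n : SimplexCategoryᵒᵖ} (σ : Simp X n) : C :=
  L.obj (.mk (simpMap σ (vertexZero n.unop)))

/-- Parallel transport in a local system `L`, inside a singular simplex `σ`, from the initial
vertex of `σ` to the initial vertex of `f^* σ`. -/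
def transport (L : FundamentalGroupoid X ⥤ C) {n m : SimplexCategoryᵒᵖ} (f : n ⟶ m)
    (σ : Simp X n) : stalk L σ ⟶ stalk L ((TopCat.toSSet.obj (TopCat.of X)).map f σ) :=
  L.map ((FundamentalGroupoid.map (simpMap σ)).map
    (simplexPath n.unop (vertexZero n.unop)
      (SimplexCategory.toTop.map f.unop (vertexZero m.unop))))

/-- Two paths in a simplex with the same end points induce the same transport. -/
theorem transport_unique (L : FundamentalGroupoid X ⥤ C) {n : SimplexCategoryᵒᵖ} (σ : Simp X n)
    {v w w' : SimplexCategory.toTop.{u}.obj n.unop} (h : w = w')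
    (a : FundamentalGroupoid.mk v ⟶ .mk w) (b : FundamentalGroupoid.mk v ⟶ .mk w') :
    L.map ((FundamentalGroupoid.map (simpMap σ)).map a) ≫ eqToHom (by rw [h]) =
      L.map ((FundamentalGroupoid.map (simpMap σ)).map b) := by
  subst h
  rw [Subsingleton.elim a b, eqToHom_refl, Category.comp_id]

/-- Transport inside a face, as transport inside the whole simplex. -/
theorem transport_face (L : FundamentalGroupoid X ⥤ C) {n m : SimplexCategoryᵒᵖ} (f : n ⟶ m)
    (σ : Simp X n) {v w : SimplexCategory.toTop.{u}.obj m.unop}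
    (a : FundamentalGroupoid.mk v ⟶ .mk w) :
    L.map ((FundamentalGroupoid.map
      (simpMap ((TopCat.toSSet.obj (TopCat.of X)).map f σ))).map a) =
    L.map ((FundamentalGroupoid.map (simpMap σ)).map
      ((FundamentalGroupoid.map (SimplexCategory.toTop.{u}.map f.unop).hom).map a)) := by
  congr 1
  induction a using Path.Homotopic.Quotient.ind with
  | mk a => rfl

variable [HasCoproducts.{u} C]

/-- Two transports to equal simplices give the same map to the coproduct. -/
theorem comp_ι_eq (L : FundamentalGroupoid X ⥤ C) {m : SimplexCategoryᵒᵖ} {c : C}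
    {τ τ' : Simp X m} (h : τ = τ') (a : c ⟶ stalk L τ) (b : c ⟶ stalk L τ')
    (hab : a ≫ eqToHom (by rw [h]) = b) :
    a ≫ Sigma.ι (fun τ : Simp X m => stalk L τ) τ =
      b ≫ Sigma.ι (fun τ : Simp X m => stalk L τ) τ' := by
  subst h
  simp [← hab]

/-- The simplicial object of singular chains with coefficients in a local system `L`: in degree
`n` it is the coproduct, over the singular `n`-simplices `σ`, of the stalks of `L` at the initial
vertex of `σ`. For constant `L` this is the usual simplicial object of singular chains. -/
def localChains (L : FundamentalGroupoid X ⥤ C) : SimplicialObject C where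
  obj n := ∐ fun σ : Simp X n => stalk L σ
  map {n m} f := Sigma.desc fun σ => transport L f σ ≫
    Sigma.ι (fun τ : Simp X m => stalk L τ) ((TopCat.toSSet.obj (TopCat.of X)).map f σ)
  map_id n := by
    apply Sigma.hom_ext
    intro σ
    rw [Sigma.ι_desc, Category.comp_id]
    have h0 : SimplexCategory.toTop.{u}.map (𝟙 n : n ⟶ n).unop (vertexZero n.unop) =
        vertexZero n.unop := by
      rw [unop_id, CategoryTheory.Functor.map_id]; rfl
    have h1 : (TopCat.toSSet.obj (TopCat.of X)).map (𝟙 n) σ = σ := by simp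
    refine (comp_ι_eq L h1 _ (𝟙 _) ?_).trans (Category.id_comp _)
    refine (transport_unique L σ h0 _ (𝟙 _)).trans ?_
    exact (congrArg L.map ((FundamentalGroupoid.map (simpMap σ)).map_id _)).trans (L.map_id _)
  map_comp {n m l} f g := by
    apply Sigma.hom_ext
    intro σ
    rw [Sigma.ι_desc, Sigma.ι_desc_assoc, Category.assoc, Sigma.ι_desc, ← Category.assoc]
    have h0 : SimplexCategory.toTop.{u}.map (f ≫ g).unop (vertexZero l.unop) =
        SimplexCategory.toTop.{u}.map f.unop
          (SimplexCategory.toTop.{u}.map g.unop (vertexZero l.unop)) := by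
      rw [unop_comp, CategoryTheory.Functor.map_comp]; rfl
    have h1 : (TopCat.toSSet.obj (TopCat.of X)).map (f ≫ g) σ =
        (TopCat.toSSet.obj (TopCat.of X)).map g ((TopCat.toSSet.obj (TopCat.of X)).map f σ) := by
      simp
    refine comp_ι_eq L h1 _ _ ?_
    refine (transport_unique L σ h0 _ (simplexPath n.unop _ _ ≫
      (FundamentalGroupoid.map (SimplexCategory.toTop.{u}.map f.unop).hom).map
        (simplexPath m.unop (vertexZero m.unop) _))).trans ?_
    refine ((congrArg L.map ((FundamentalGroupoid.map (simpMap σ)).map_comp _ _)).trans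
      (L.map_comp _ _)).trans ?_
    exact congrArg (transport L f σ ≫ ·) (transport_face L f σ _).symm

/-- The `q`-th singular homology object of `X` with coefficients in the local system `L`. -/
def localHomology [Preadditive C] [CategoryWithHomology C] (L : FundamentalGroupoid X ⥤ C)
    (q : ℕ) : C :=
  ((AlgebraicTopology.alternatingFaceMapComplex C).obj (localChains L)).homology q

end Chains

/-! ### Rank one local systems -/

section RankOne

variable {X : Type u} [TopologicalSpace X] {x₀ : X} {k : Type v} [Field k]

/-- The stalk at `x` of the rank one local system of a character `ρ` of `π₁(X, x₀)`: the
`k`-valued functions `f` on homotopy classes of paths from `x₀` to `x` such that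
`f (g p) = ρ(g)⁻¹ f (p)` for every loop `g` at `x₀`. -/
def charStalk (ρ : FundamentalGroup X x₀ →* kˣ) (x : FundamentalGroupoid X) :
    Submodule k ((FundamentalGroupoid.mk x₀ ⟶ x) → k) where
  carrier := {f | ∀ (g : FundamentalGroup X x₀) (p : FundamentalGroupoid.mk x₀ ⟶ x),
    f (FundamentalGroup.toArrow g ≫ p) = ((ρ g)⁻¹ : kˣ) * f p}
  add_mem' {a b} ha hb g p := by simp [ha g p, hb g p, mul_add]
  zero_mem' g p := by simp
  smul_mem' c a ha g p := by simp [ha g p, mul_left_comm]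

/-- Parallel transport along `r : x ⟶ y`, given by `(r f)(p) = f (p r⁻¹)`. -/
def charTransport (ρ : FundamentalGroup X x₀ →* kˣ) {x y : FundamentalGroupoid X} (r : x ⟶ y) :
    charStalk ρ x →ₗ[k] charStalk ρ y where
  toFun f := ⟨fun p => f.1 (p ≫ Groupoid.inv r), fun g p => by
    simpa only [Category.assoc] using f.2 g (p ≫ Groupoid.inv r)⟩
  map_add' _ _ := rfl
  map_smul' _ _ := rfl

/-- The rank one local system `k_ρ` on `X`: the monodromy along a loop `g` at `x₀` is
multiplication by `ρ(g)`. -/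
def charLocalSystem (ρ : FundamentalGroup X x₀ →* kˣ) :
    FundamentalGroupoid X ⥤ ModuleCat.{max u v} k where
  obj x := ModuleCat.of k (charStalk ρ x)
  map r := ModuleCat.ofHom (charTransport ρ r)
  map_id x := by
    ext f p
    simp [charTransport]
  map_comp r s := by
    ext f p
    simp [charTransport]

/-- The homology groups `H_q(X, k_ρ)`. -/
abbrev charHomology (ρ : FundamentalGroup X x₀ →* kˣ) (q : ℕ) : ModuleCat.{max u v} k :=
  localHomology (charLocalSystem ρ) q

variable (X x₀ k) in
/-- The characteristic variety `V^q_s(X, k)`: the set of those characters `ρ : π₁(X, x₀) → kˣ`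
such that `dim_k H_q(X, k_ρ) ≥ s`. -/
def charVariety (q s : ℕ) : Set (FundamentalGroup X x₀ →* kˣ) :=
  {ρ | (s : Cardinal) ≤ Module.rank k (charHomology ρ q)}

end RankOne

/-- The singular homology `H_q(Y, k)` with (constant) coefficients in `k`. -/
abbrev singularHomology (k : Type v) [Field k] (Y : Type w) [TopologicalSpace Y] (q : ℕ) :
    ModuleCat.{max w v} k :=
  ((AlgebraicTopology.singularHomologyFunctor (ModuleCat.{max w v} k) q).obj
    (ModuleCat.of k (ULift.{w} k))).obj (TopCat.of Y)

/-- `p : (Y, y₀) → (X, x₀)` is a regular connected cover of `X` with classifying homomorphism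
`χ : π₁(X, x₀) ↠ A`. -/
structure IsRegularCover {X : Type u} {Y : Type w} [TopologicalSpace X] [TopologicalSpace Y]
    {A : Type*} [Group A] {x₀ : X} (χ : FundamentalGroup X x₀ →* A) (p : C(Y, X)) (y₀ : Y) :
    Prop where
  connected : ConnectedSpace Y
  isCoveringMap : IsCoveringMap p
  base : p y₀ = x₀
  range_eq : (FundamentalGroup.mapOfEq p base).range = χ.ker

end AbelianCover

end

/-! A lift to the cover Y of a singular simplex σ of X is determined by its initial vertex. Once a
path from the base point to the initial vertex of σ is fixed, the lifts of σ form a torsor under A,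
so the chains of Y over σ are a copy of the regular representation k[A]. Since k is algebraically
closed and |A| is invertible in it, k[A] splits into lines indexed by the characters φ of A, and the
line of φ is the stalk of the local system of φ ∘ χ. Thus a discrete Fourier transform identifies
C(Y, k) with the product over φ of C(X, k_{φ∘χ}).

The transform is `toLocalChains`, which sends a simplex τ to the family over φ of its
`fiberElement`, placed at p ∘ τ. It is injective by Fourier inversion (`toLocalChains_injective`),
surjective by orthogonality (`toLocalChains_surjective`), and a chain map because fibre elements are
flat (`toLocalChains_d`). Homology respects the product (`nonempty_homology_linearEquiv_pi`), so dim
H_q(Y, k) is the sum over φ of dim H_q(X, k_{φ∘χ}). Writing each dimension as the number of s ≥ 1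
not exceeding it and exchanging sums (`tsum_encard_range_inter`) gives the formula. The CW structure
supplies local path connectedness, which makes X and Y path connected. -/

noncomputable section

namespace AbelianCover

universe u v w

/-! ### Local path connectedness -/

/-- A CW complex is locally path connected. -/
theorem locallyPathConnectedSpace_of_cwComplex (X : Type*) [TopologicalSpace X] [T2Space X]
    [Topology.CWComplex (Set.univ : Set X)] : LocallyPathConnectedSpace X := by
  let ι := Σ n, Topology.CWComplex.cell (Set.univ : Set X) n
  let f : (Σ i : ι, Metric.closedBall (0 : Fin i.1 → ℝ) 1) → X := fun z =>
    Topology.RelCWComplex.map (C := (Set.univ : Set X)) z.1.1 z.1.2 z.2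
  have hf : Continuous f := continuous_sigma fun i =>
    continuousOn_iff_continuous_domRestrict.mp
      (Topology.RelCWComplex.continuousOn (C := (Set.univ : Set X)) i.1 i.2)
  have : ∀ i : ι, LocallyPathConnectedSpace (Metric.closedBall (0 : Fin i.1 → ℝ) 1) :=
    fun i => (convex_closedBall _ _).locallyPathConnectedSpace
  -- The weak topology makes X a quotient of the disjoint union of its closed balls, and balls are
  -- locally path connected.
  have hq : Topology.IsQuotientMap f := by
    refine Topology.isQuotientMap_iff_isClosed.mpr ⟨fun x => ?_, fun s =>
      ⟨fun h => h.preimage hf, fun h => ?_⟩⟩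
    · have hx : x ∈ ⋃ (n : ℕ) (j : Topology.RelCWComplex.cell (Set.univ : Set X) n),
          Topology.RelCWComplex.closedCell (C := (Set.univ : Set X)) n j := by
        rw [Topology.CWComplex.union]; trivial
      simp only [Set.mem_iUnion] at hx
      obtain ⟨n, j, b, hb, rfl⟩ := hx
      exact ⟨⟨⟨n, j⟩, ⟨b, hb⟩⟩, rfl⟩
    · refine Topology.CWComplex.closed' (C := (Set.univ : Set X)) s (Set.subset_univ _)
        fun n j => ?_
      -- The trace of `s` on a closed cell is the image of a compact set, hence closed because X is
      -- Hausdorff.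
      have hc : IsCompact ((fun b : Metric.closedBall (0 : Fin n → ℝ) 1 => f ⟨⟨n, j⟩, b⟩) ''
          ((fun b => f ⟨⟨n, j⟩, b⟩) ⁻¹' s)) :=
        ((h.preimage (continuous_sigmaMk (σ := fun i : ι => Metric.closedBall (0 : Fin i.1 → ℝ) 1)
          (i := ⟨n, j⟩))).isCompact).image (hf.comp continuous_sigmaMk)
      convert! hc.isClosed using 1
      ext x
      constructor
      · rintro ⟨hs, b, hb, rfl⟩
        exact ⟨⟨b, hb⟩, hs, rfl⟩
      · rintro ⟨b, hb, rfl⟩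
        exact ⟨hb, b, b.2, rfl⟩
  exact hq.locallyPathConnectedSpace

/-- The source of a local homeomorphism to a locally path connected space is locally path
connected. -/
theorem _root_.IsLocalHomeomorph.locallyPathConnectedSpace {X Y : Type*} [TopologicalSpace X]
    [TopologicalSpace Y] [LocallyPathConnectedSpace X] {f : Y → X} (hf : IsLocalHomeomorph f) :
    LocallyPathConnectedSpace Y := by
  choose e he _ using hf
  let _ : ChartedSpace X Y :=
    { atlas := Set.range e
      chartAt := e
      mem_chart_source := he
      chart_mem_atlas := fun y => ⟨y, rfl⟩ }
  exact ChartedSpace.locallyPathConnectedSpace X Y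

/-- Together with simple connectedness, this lets maps from a simplex be lifted through a covering.
-/
instance simplex_locallyPathConnected (n : SimplexCategory) :
    LocallyPathConnectedSpace (SimplexCategory.toTop.{u}.obj n) := by
  have : LocallyPathConnectedSpace (stdSimplex ℝ (Fin (n.len + 1))) :=
    (convex_stdSimplex ℝ (Fin (n.len + 1))).locallyPathConnectedSpace
  exact (Homeomorph.ulift.{u} (X := stdSimplex ℝ (Fin (n.len + 1)))).symm.isQuotientMap
    |>.locallyPathConnectedSpace

/-! ### Homology of a product of complexes of modules -/

section Homology

universe a b c

variable {k : Type c} [Field k] {Φ : Type*}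

/-- A short complex of modules which is a product of short complexes, possibly in another universe,
has the product of their homologies as homology. -/
theorem nonempty_shortComplex_homology_linearEquiv_pi (S : ShortComplex (ModuleCat.{a} k))
    (T : Φ → ShortComplex (ModuleCat.{b} k)) (E₁ : S.X₁ ≃ₗ[k] ∀ φ, (T φ).X₁)
    (E₂ : S.X₂ ≃ₗ[k] ∀ φ, (T φ).X₂) (E₃ : S.X₃ ≃ₗ[k] ∀ φ, (T φ).X₃)
    (hf : ∀ x φ, E₂ (S.f x) φ = (T φ).f (E₁ x φ)) (hg : ∀ x φ, E₃ (S.g x) φ = (T φ).g (E₂ x φ)) :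
    Nonempty (S.homology ≃ₗ[k] ∀ φ, (T φ).homology) := by
  let Z (φ : Φ) : LinearMap.ker S.g.hom →ₗ[k] LinearMap.ker (T φ).g.hom :=
    ((LinearMap.proj φ ∘ₗ E₂.toLinearMap) ∘ₗ Submodule.subtype _).codRestrict _ fun z => by
      refine (hg z φ).symm.trans ?_
      have hz : S.g z = 0 := z.2
      rw [hz, map_zero]; rfl
  -- Homology is handled as cycles modulo boundaries: the two sides live in different universes, so
  -- a linear equivalence replaces a categorical isomorphism. `Θ` sends a cycle to the classes of
  -- its components.
  let Θ : LinearMap.ker S.g.hom →ₗ[k]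
      ∀ φ, (LinearMap.ker (T φ).g.hom ⧸ LinearMap.range (T φ).moduleCatToCycles) :=
    LinearMap.pi fun φ => Submodule.mkQ _ ∘ₗ Z φ
  have hΘ : Function.Surjective Θ := by
    intro h
    choose z hz using fun φ => Submodule.mkQ_surjective _ (h φ)
    refine ⟨⟨E₂.symm fun φ => (z φ).1, E₃.injective (funext fun φ => ?_)⟩, funext fun φ => ?_⟩
    · refine (hg _ φ).trans ?_
      rw [LinearEquiv.apply_symm_apply, map_zero]
      exact (z φ).2
    · rw [← hz φ]
      exact congrArg (Submodule.mkQ _) (Subtype.ext (congrFun (E₂.apply_symm_apply _) φ))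
  have hker : LinearMap.range S.moduleCatToCycles = LinearMap.ker Θ := by
    ext z
    rw [LinearMap.mem_ker, funext_iff]
    constructor
    · rintro ⟨x, rfl⟩ φ
      exact (Submodule.Quotient.mk_eq_zero _).mpr ⟨E₁ x φ, Subtype.ext (hf x φ).symm⟩
    · intro h
      choose x hx using fun φ => (Submodule.Quotient.mk_eq_zero _).mp (h φ)
      refine ⟨E₁.symm x, Subtype.ext (E₂.injective (funext fun φ => ?_))⟩
      refine (hf _ φ).trans ?_
      rw [LinearEquiv.apply_symm_apply]
      exact congrArg Subtype.val (hx φ)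
  exact ⟨(S.moduleCatHomologyIso.toLinearEquiv.trans
    ((Submodule.quotEquivOfEq _ _ hker).trans (Θ.quotKerEquivOfSurjective hΘ))).trans
    (LinearEquiv.piCongrRight fun φ => (T φ).moduleCatHomologyIso.toLinearEquiv.symm)⟩

/-- A complex of modules which is a product of complexes, possibly in another universe, has
the product of their homologies as homology. -/
theorem nonempty_homology_linearEquiv_pi (K : ChainComplex (ModuleCat.{a} k) ℕ)
    (L : Φ → ChainComplex (ModuleCat.{b} k) ℕ) (E : ∀ n, K.X n ≃ₗ[k] ∀ φ, (L φ).X n)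
    (hE : ∀ n x φ, E n (K.d (n + 1) n x) φ = (L φ).d (n + 1) n (E (n + 1) x φ)) (q : ℕ) :
    Nonempty (K.homology q ≃ₗ[k] ∀ φ, (L φ).homology q) := by
  have hE' (i j : ℕ) (x : K.X i) (φ : Φ) : E j (K.d i j x) φ = (L φ).d i j (E i x φ) := by
    by_cases h : j + 1 = i
    · subst h; exact hE j x φ
    · rw [K.shape i j h, (L φ).shape i j h]; simp
  exact nonempty_shortComplex_homology_linearEquiv_pi (K.sc q) (fun φ => (L φ).sc q) (E _) (E _)
    (E _) (hE' _ _) (hE' _ _)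

theorem toENat_cardinal_sum {Φ : Type*} [inst : Fintype Φ] (f : Φ → Cardinal) :
    Cardinal.toENat (Cardinal.sum f) = ∑ φ, Cardinal.toENat (f φ) := by
  revert f
  refine Fintype.induction_empty_option ?_ ?_ ?_ Φ (h_fintype := inst)
  · intro α β _ e h f
    let := Fintype.ofEquiv β e.symm
    rw [← e.sum_comp, ← h]
    exact congrArg _ (Cardinal.mk_congr (Equiv.sigmaCongrLeft e (β := fun b => (f b).out)).symm)
  · intro f
    simp [Cardinal.sum]
  · intro α _ h f
    let e : (Σ a : Option α, (f a).out) ≃ (f none).out ⊕ Σ a : α, (f (some a)).out :=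
      { toFun := fun
          | ⟨none, x⟩ => Sum.inl x
          | ⟨some a, x⟩ => Sum.inr ⟨a, x⟩
        invFun := fun
          | Sum.inl x => ⟨none, x⟩
          | Sum.inr x => ⟨some x.1, x.2⟩
        left_inv := by rintro ⟨_ | a, x⟩ <;> rfl
        right_inv := by rintro (x | x) <;> rfl }
    rw [Fintype.sum_option, ← h, Cardinal.sum, Cardinal.mk_congr e, Cardinal.mk_sum]
    simp

theorem toENat_rank_pi {M : Φ → Type*} [Fintype Φ] [∀ φ, AddCommGroup (M φ)]
    [∀ φ, Module k (M φ)] :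
    Cardinal.toENat (Module.rank k (∀ φ, M φ)) = ∑ φ, Cardinal.toENat (Module.rank k (M φ)) := by
  rw [rank_pi, toENat_cardinal_sum]

end Homology

/-! ### Counting -/

/-- Layer-cake count: exactly n of the integers 1, 2, 3, … are at most n. The index starts at 0,
hence the shift by one. -/
theorem hasSum_ite_succ_le (n : ℕ∞) :
    HasSum (fun s : ℕ => if ((s + 1 : ℕ) : ℕ∞) ≤ n then (1 : ℕ∞) else 0) n := by
  induction n using ENat.recTopCoe with
  | top =>
    simp only [le_top, if_true]
    refine (ENat.tendsto_natCast_nhds_top.comp Filter.tendsto_card_atTop_atTop).congr fun s => ?_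
    simp
  | coe n =>
    have h : HasSum (fun s : ℕ => if ((s + 1 : ℕ) : ℕ∞) ≤ n then (1 : ℕ∞) else 0)
        (∑ s ∈ Finset.range n, if ((s + 1 : ℕ) : ℕ∞) ≤ n then (1 : ℕ∞) else 0) :=
      hasSum_sum_of_ne_finset_zero fun s hs => if_neg (by
        rw [Finset.mem_range] at hs
        rw [Nat.cast_le]
        omega)
    rwa [Finset.sum_congr rfl (g := fun _ => 1) fun s hs =>
      if_pos (by exact_mod_cast Finset.mem_range.mp hs), Finset.sum_const, Finset.card_range,
      nsmul_one] at h

/-- Both sides count pairs (φ, s) with 1 ≤ s ≤ r (f φ); injectivity of `f` prevents an element of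
the range from standing for several φ. -/
theorem tsum_encard_range_inter {Φ S : Type*} [Fintype Φ] {f : Φ → S} (hf : f.Injective)
    (r : S → Cardinal) :
    ∑' s : ℕ, (Set.range f ∩ {x | ((s + 1 : ℕ) : Cardinal) ≤ r x}).encard =
      ∑ φ, Cardinal.toENat (r (f φ)) := by
  classical
  refine HasSum.tsum_eq ?_
  convert! hasSum_sum (s := Finset.univ) fun φ _ =>
    hasSum_ite_succ_le (Cardinal.toENat (r (f φ))) using 2 with s
  have h : Set.range f ∩ {x | ((s + 1 : ℕ) : Cardinal) ≤ r x} =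
      f '' ↑(Finset.univ.filter fun φ => ((s + 1 : ℕ) : ℕ∞) ≤ Cardinal.toENat (r (f φ))) := by
    ext x
    constructor
    · rintro ⟨⟨φ, rfl⟩, h⟩
      exact ⟨φ, Finset.mem_coe.mpr (Finset.mem_filter.mpr
        ⟨Finset.mem_univ _, Cardinal.natCast_le_toENat.mpr h⟩), rfl⟩
    · rintro ⟨φ, h, rfl⟩
      exact ⟨⟨φ, rfl⟩, Cardinal.natCast_le_toENat.mp (Finset.mem_filter.mp h).2⟩
  rw [h, hf.encard_image, Set.encard_coe_eq_coe_finsetCard, Finset.sum_boole]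

/-! ### Orthogonality of characters -/

section Characters

variable {A : Type*} [CommGroup A] [Fintype A] {k : Type*} [Field k]

/-- A nontrivial homomorphism from a finite group to the units of a field sums to zero; it is
applied to φ⁻¹ψ on A. -/
theorem sum_inv_mul_characters [DecidableEq (A →* kˣ)] (φ ψ : A →* kˣ) :
    ∑ a, (((φ a)⁻¹ : kˣ) : k) * ψ a = if ψ = φ then (Fintype.card A : k) else 0 := by
  classical
  have h1 : (Units.coeHom k).comp (φ⁻¹ * ψ) = 1 ↔ ψ = φ := by
    refine ⟨fun h => ?_, fun h => by subst h; ext; simp⟩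
    rw [← inv_mul_eq_one, inv_mul_eq_one, eq_comm, ← inv_mul_eq_one]
    exact MonoidHom.ext fun a => Units.ext (DFunLike.congr_fun h a)
  have := sum_hom_units ((Units.coeHom k).comp (φ⁻¹ * ψ))
  simp only [h1] at this
  simpa using this

/-- The dual relation, from evaluation at `a` as a character of the dual group. Roots of unity are
needed so that characters separate points and are as numerous as the elements of A. -/
theorem sum_characters [DecidableEq A] [HasEnoughRootsOfUnity k (Monoid.exponent A)]
    [Fintype (A →* kˣ)] (a : A) :
    ∑ φ : A →* kˣ, ((φ a : kˣ) : k) = if a = 1 then (Fintype.card A : k) else 0 := by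
  classical
  let ev : (A →* kˣ) →* k := (Units.coeHom k).comp (MonoidHom.eval a)
  have h1 : ev = 1 ↔ a = 1 := by
    refine ⟨fun h => ?_, fun h => MonoidHom.ext fun φ => by simp [ev, h]⟩
    by_contra ha
    obtain ⟨φ, hφ⟩ := CommGroup.exists_apply_ne_one_of_hasEnoughRootsOfUnity A k ha
    exact hφ (Units.ext (DFunLike.congr_fun h φ))
  have hc : Fintype.card (A →* kˣ) = Fintype.card A := by
    simpa [Nat.card_eq_fintype_card] using CommGroup.card_monoidHom_of_hasEnoughRootsOfUnity A k
  have := sum_hom_units ev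
  simp only [h1, hc] at this
  simpa [ev] using this

end Characters

/-! ### Paths in a regular cover -/

section Paths

variable {X : Type u} [TopologicalSpace X]

theorem comp_eqToHom_eq_cast {x y z : X} (γ : FundamentalGroupoid.mk x ⟶ .mk y) (h : y = z) :
    γ ≫ eqToHom (congrArg FundamentalGroupoid.mk h) =
      Path.Homotopic.Quotient.cast γ rfl h.symm := by
  subst h
  simp

theorem eq_comp_of_eq_comp_inv {G : Type*} [Groupoid G] {x y z w : G} {s : x ⟶ y} {a : x ⟶ z}
    {b : y ⟶ w} {e : w ⟶ z} (h : s = a ≫ Groupoid.inv (b ≫ e)) : a = (s ≫ b) ≫ e := by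
  simp [h]

/-- The value of a homomorphism from the fundamental group on a loop. -/
def loopValue {x : X} {A : Type*} [Group A] (χ : FundamentalGroup X x →* A)
    (a : FundamentalGroupoid.mk x ⟶ .mk x) : A :=
  χ (FundamentalGroup.fromArrow a)

theorem loopValue_id {x : X} {A : Type*} [Group A] (χ : FundamentalGroup X x →* A) :
    loopValue χ (𝟙 _) = 1 :=
  map_one χ

theorem loopValue_comp {x : X} {A : Type*} [CommGroup A] (χ : FundamentalGroup X x →* A)
    (a b : FundamentalGroupoid.mk x ⟶ .mk x) :
    loopValue χ (a ≫ b) = loopValue χ a * loopValue χ b := by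
  -- Multiplication in the fundamental group reverses concatenation; commutativity of A absorbs the
  -- reversal.
  rw [mul_comm]; exact χ.map_mul b a

theorem loopValue_inv {x : X} {A : Type*} [CommGroup A] (χ : FundamentalGroup X x →* A)
    (a : FundamentalGroupoid.mk x ⟶ .mk x) :
    loopValue χ (Groupoid.inv a) = (loopValue χ a)⁻¹ := by
  rw [eq_inv_iff_mul_eq_one, ← loopValue_comp, Groupoid.inv_comp, loopValue_id]

/-- The image of a homotopy class of paths under a continuous map. -/
def mapPath {Y : Type w} [TopologicalSpace Y] (p : C(Y, X)) {y y' : Y}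
    (s : FundamentalGroupoid.mk y ⟶ .mk y') :
    FundamentalGroupoid.mk (p y) ⟶ FundamentalGroupoid.mk (p y') :=
  (FundamentalGroupoid.map p).map s

theorem mapPath_eq_map {Y : Type w} [TopologicalSpace Y] (p : C(Y, X)) {y y' : Y}
    (s : FundamentalGroupoid.mk y ⟶ .mk y') : mapPath p s = Path.Homotopic.Quotient.map s p := by
  induction s using Path.Homotopic.Quotient.ind with
  | mk s => rfl

theorem mapPath_comp {Y : Type w} [TopologicalSpace Y] (p : C(Y, X)) {y y' y'' : Y}
    (s : FundamentalGroupoid.mk y ⟶ .mk y') (t : FundamentalGroupoid.mk y' ⟶ .mk y'') :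
    mapPath p (s ≫ t) = mapPath p s ≫ mapPath p t :=
  (FundamentalGroupoid.map p).map_comp s t

end Paths

section Cover

variable {X : Type u} {Y : Type w} [TopologicalSpace X] [TopologicalSpace Y]
  {A : Type*} [CommGroup A] {p : C(Y, X)} {y₀ : Y} {χ : FundamentalGroup X (p y₀) →* A}

/-- The condition im p_♯ = ker χ in terms of paths: χ kills exactly the loops that lift to loops at
`y₀`. -/
theorem IsRegularCover.loopValue_eq_one_iff (hp : IsRegularCover χ p y₀)
    (g : FundamentalGroupoid.mk (p y₀) ⟶ .mk (p y₀)) :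
    loopValue χ g = 1 ↔ ∃ s : FundamentalGroupoid.mk y₀ ⟶ .mk y₀, mapPath p s = g := by
  rw [loopValue, ← MonoidHom.mem_ker, ← hp.range_eq]
  have h (s : FundamentalGroup Y y₀) : FundamentalGroup.mapOfEq p hp.base s = mapPath p s := by
    rw [FundamentalGroup.mapOfEq_apply, Path.Homotopic.Quotient.cast_rfl_rfl, mapPath_eq_map]
  constructor
  · rintro ⟨s, hs⟩; exact ⟨s, (h s).symm.trans hs⟩
  · rintro ⟨s, hs⟩; exact ⟨s, (h s).trans hs⟩

/-- The difference in `A` between a path of `Y` from the base point to `y` and a path of `X` with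
the same end points does not depend on the path in `Y`. -/
theorem IsRegularCover.loopValue_mapPath_comp_inv (hp : IsRegularCover χ p y₀) {y : Y}
    (s s' : FundamentalGroupoid.mk y₀ ⟶ .mk y)
    (r : FundamentalGroupoid.mk (p y₀) ⟶ .mk (p y)) :
    loopValue χ (mapPath p s ≫ Groupoid.inv r) = loopValue χ (mapPath p s' ≫ Groupoid.inv r) := by
  have h : mapPath p s ≫ Groupoid.inv r =
      mapPath p (s ≫ Groupoid.inv s') ≫ (mapPath p s' ≫ Groupoid.inv r) := by
    rw [← Category.assoc, ← mapPath_comp, Category.assoc, Groupoid.inv_comp, Category.comp_id]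
  rw [h, loopValue_comp, (hp.loopValue_eq_one_iff _).mpr ⟨_, rfl⟩, one_mul]

/-- By homotopy lifting, the end point of a lift from `y₀` depends only on the homotopy class below.
-/
theorem eq_of_mapPath_eq (hp : IsCoveringMap p) {y y' : Y} (h : p y' = p y)
    (s : FundamentalGroupoid.mk y₀ ⟶ .mk y) (s' : FundamentalGroupoid.mk y₀ ⟶ .mk y')
    (hs : mapPath p s = mapPath p s' ≫ eqToHom (congrArg FundamentalGroupoid.mk h)) : y = y' := by
  rw [comp_eqToHom_eq_cast _ h] at hs
  have h1 := hp.monodromy_map s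
  have h2 := hp.monodromy_eq_of_map_eq (γ := mapPath p s) (ex := ⟨y₀, rfl⟩) (ey := ⟨y', h⟩) s'
    (by
      rw [hs]
      exact (mapPath_eq_map p s').symm.trans ((Path.Homotopic.Quotient.cast_cast _ _ _ _ _).trans
        (Path.Homotopic.Quotient.cast_rfl_rfl _)).symm)
  rw [mapPath_eq_map] at h2
  exact congrArg Subtype.val (h1.symm.trans h2)

theorem exists_mapPath_eq (hp : IsCoveringMap p) {x : X}
    (q : FundamentalGroupoid.mk (p y₀) ⟶ .mk x) :
    ∃ (y : Y) (hy : p y = x) (s : FundamentalGroupoid.mk y₀ ⟶ .mk y),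
      mapPath p s ≫ eqToHom (congrArg FundamentalGroupoid.mk hy) = q := by
  refine ⟨_, (hp.monodromy q ⟨y₀, rfl⟩).2, hp.liftPathQuotient q ⟨y₀, rfl⟩, ?_⟩
  rw [comp_eqToHom_eq_cast _ (hp.monodromy q ⟨y₀, rfl⟩).2, mapPath_eq_map]
  refine (congrArg (fun z => Path.Homotopic.Quotient.cast z _ _)
    (hp.map_liftPathQuotient q ⟨y₀, rfl⟩)).trans ?_
  exact (Path.Homotopic.Quotient.cast_cast _ _ _ _ _).trans
    (Path.Homotopic.Quotient.cast_rfl_rfl _)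

/-! ### Lifting singular simplices -/

/-- The image of a singular simplex of `Y` under `p`. -/
def pushSimp (p : C(Y, X)) {n : SimplexCategoryᵒᵖ} (τ : Simp Y n) : Simp X n :=
  ULift.up (TopCat.ofHom ((p.comp (simpMap τ)).comp
    (⟨fun z => ULift.up z.down, by fun_prop⟩ :
      C(SimplexCategory.toTop.{u}.obj n.unop, SimplexCategory.toTop.{w}.obj n.unop))))

/-- Uniqueness of lifts on a connected simplex. -/
theorem pushSimp_injective (hp : IsCoveringMap p) {n : SimplexCategoryᵒᵖ} {τ τ' : Simp Y n}
    (h : pushSimp p τ = pushSimp p τ')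
    (h0 : simpMap τ (vertexZero n.unop) = simpMap τ' (vertexZero n.unop)) : τ = τ' := by
  have : (simpMap τ : _ → Y) = simpMap τ' := by
    refine hp.eq_of_comp_eq (simpMap τ).continuous (simpMap τ').continuous (funext fun z => ?_)
      (vertexZero n.unop) h0
    exact congrArg (fun σ => simpMap σ (ULift.up z.down)) h
  exact congrArg (fun f => (ULift.up (TopCat.ofHom f) : Simp Y n)) (DFunLike.coe_injective this)

theorem exists_pushSimp_eq (hp : IsCoveringMap p) {n : SimplexCategoryᵒᵖ} (σ : Simp X n) (y : Y)
    (hy : p y = simpMap σ (vertexZero n.unop)) :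
    ∃ τ : Simp Y n, pushSimp p τ = σ ∧ simpMap τ (vertexZero n.unop) = y := by
  let c : C(SimplexCategory.toTop.{w}.obj n.unop, SimplexCategory.toTop.{u}.obj n.unop) :=
    ⟨fun z => ULift.up z.down, by fun_prop⟩
  obtain ⟨F, ⟨h0, hF⟩, -⟩ := hp.existsUnique_continuousMap_lifts ((simpMap σ).comp c)
    (vertexZero n.unop) y hy
  refine ⟨ULift.up (TopCat.ofHom F), ?_, h0⟩
  refine congrArg (fun f => (ULift.up (TopCat.ofHom f) : Simp X n)) ?_
  ext z
  exact congrFun hF (ULift.up z.down)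

/-! ### The fibre as a family of sections of local systems -/

variable [PathConnectedSpace Y]

variable (y₀) in
/-- A path from `y₀` to `y`. -/
def basePath (y : Y) : FundamentalGroupoid.mk y₀ ⟶ .mk y :=
  Path.Homotopic.Quotient.mk (PathConnectedSpace.somePath y₀ y)

variable (p y₀) in
/-- The image in `X` of a path from `y₀` to `y`. -/
def pathClass (y : Y) : FundamentalGroupoid.mk (p y₀) ⟶ .mk (p y) :=
  mapPath p (basePath y₀ y)

variable {k : Type v} [Field k]

variable (p y₀ χ) in
/-- The element of the stalk over `p y` of the local system of `φ ∘ χ` defined by `y`. -/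
def fiberElement (φ : A →* kˣ) (y : Y) : charStalk (φ.comp χ) (FundamentalGroupoid.mk (p y)) :=
  ⟨fun r => (φ (loopValue χ (pathClass p y₀ y ≫ Groupoid.inv r)) : kˣ), fun g r => by
    have h : pathClass p y₀ y ≫ Groupoid.inv (FundamentalGroup.toArrow g ≫ r) =
        (pathClass p y₀ y ≫ Groupoid.inv r) ≫ Groupoid.inv (FundamentalGroup.toArrow g) := by
      simp
    beta_reduce
    rw [h, loopValue_comp, loopValue_inv, map_mul, mul_comm, map_inv, Units.val_mul]
    rfl⟩

/-- The fibre elements form a flat section of the local system pulled back to Y. Changing the chosen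
path to `y'` only inserts a loop killed by χ. -/
theorem IsRegularCover.charTransport_fiberElement (hp : IsRegularCover χ p y₀) (φ : A →* kˣ)
    {y y' : Y} (t : FundamentalGroupoid.mk y ⟶ .mk y') :
    charTransport (φ.comp χ) (mapPath p t) (fiberElement p y₀ χ φ y) =
      fiberElement p y₀ χ φ y' := by
  refine Subtype.ext (funext fun r => ?_)
  refine congrArg (fun a => ((φ a : kˣ) : k)) ?_
  refine Eq.trans (congrArg _ ?_) (hp.loopValue_mapPath_comp_inv (basePath y₀ y ≫ t) _ r)
  simp [pathClass, mapPath_comp]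

/-- Any two paths from `x₀` to `x` differ by a loop at `x₀`, so equivariance determines an element
from one value. -/
theorem charStalk_ext {x₀ : X} {ρ : FundamentalGroup X x₀ →* kˣ} {x : FundamentalGroupoid X}
    {f f' : charStalk ρ x} (r : FundamentalGroupoid.mk x₀ ⟶ x) (h : f.1 r = f'.1 r) : f = f' := by
  refine Subtype.ext (funext fun r' => ?_)
  have e : r' = FundamentalGroup.toArrow (r' ≫ Groupoid.inv r) ≫ r := by simp
  rw [e, f.2, f'.2, h]

theorem IsRegularCover.transport_fiberElement (hp : IsRegularCover χ p y₀) (φ : A →* kˣ)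
    {n m : SimplexCategoryᵒᵖ} (f : n ⟶ m) (τ : Simp Y n) :
    transport (charLocalSystem (φ.comp χ)) f (pushSimp p τ)
      (fiberElement p y₀ χ φ (simpMap τ (vertexZero n.unop))) =
    fiberElement p y₀ χ φ (simpMap ((TopCat.toSSet.obj (TopCat.of Y)).map f τ)
      (vertexZero m.unop)) := by
  let c : C(SimplexCategory.toTop.{u}.obj n.unop, SimplexCategory.toTop.{w}.obj n.unop) :=
    ⟨fun z => ULift.up z.down, by fun_prop⟩
  have key {v w : SimplexCategory.toTop.{u}.obj n.unop}
      (a : FundamentalGroupoid.mk v ⟶ .mk w) :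
      mapPath (simpMap (pushSimp p τ)) a = mapPath p (mapPath (simpMap τ) (mapPath c a)) := by
    induction a using Path.Homotopic.Quotient.ind with
    | mk a => rfl
  refine Eq.trans ?_ (hp.charTransport_fiberElement φ (mapPath (simpMap τ) (mapPath c
    (simplexPath n.unop (vertexZero n.unop)
      (SimplexCategory.toTop.map f.unop (vertexZero m.unop))))))
  exact congrArg (fun r => charTransport (φ.comp χ) r _) (key _)

/-- Freeness of the torsor of lifts: if the difference of two lifts is trivial, it comes from a loop
in Y, so their initial vertices agree. -/
theorem IsRegularCover.eq_of_loopValue_eq_one (hp : IsRegularCover χ p y₀) {n : SimplexCategoryᵒᵖ}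
    {τ τ' : Simp Y n} (h : pushSimp p τ' = pushSimp p τ)
    (h1 : loopValue χ (pathClass p y₀ (simpMap τ (vertexZero n.unop)) ≫
      Groupoid.inv (pathClass p y₀ (simpMap τ' (vertexZero n.unop)) ≫
        eqToHom (congrArg (fun σ => FundamentalGroupoid.mk (simpMap σ (vertexZero n.unop))) h))) =
      1) : τ = τ' := by
  obtain ⟨s, hs⟩ := (hp.loopValue_eq_one_iff _).mp h1
  refine pushSimp_injective hp.isCoveringMap h.symm ?_
  refine eq_of_mapPath_eq hp.isCoveringMap
    (congrArg (fun σ => simpMap σ (vertexZero n.unop)) h) (basePath y₀ _) (s ≫ basePath y₀ _) ?_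
  rw [mapPath_comp]
  exact eq_comp_of_eq_comp_inv hs

/-- Transitivity of the torsor of lifts: choose a loop `g` with χ(g) = a, lift `g` followed by `r`,
and lift σ from the end point. -/
theorem IsRegularCover.exists_loopValue_eq (hp : IsRegularCover χ p y₀)
    (hχ : Function.Surjective χ) {n : SimplexCategoryᵒᵖ} (σ : Simp X n)
    (r : FundamentalGroupoid.mk (p y₀) ⟶ .mk (simpMap σ (vertexZero n.unop))) (a : A) :
    ∃ (τ : Simp Y n) (h : pushSimp p τ = σ),
      loopValue χ ((pathClass p y₀ (simpMap τ (vertexZero n.unop)) ≫ eqToHom (congrArg (fun σ =>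
          FundamentalGroupoid.mk (simpMap σ (vertexZero n.unop))) h)) ≫ Groupoid.inv r) = a := by
  obtain ⟨g, rfl⟩ := hχ a
  obtain ⟨y, hy, s, hs⟩ := exists_mapPath_eq hp.isCoveringMap (FundamentalGroup.toArrow g ≫ r)
  obtain ⟨τ, rfl, rfl⟩ := exists_pushSimp_eq hp.isCoveringMap σ y hy
  refine ⟨τ, rfl, ?_⟩
  have hs' : mapPath p s = FundamentalGroup.toArrow g ≫ r := (Category.comp_id _).symm.trans hs
  refine (congrArg (fun z => loopValue χ (z ≫ Groupoid.inv r)) (Category.comp_id _)).trans ?_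
  refine (hp.loopValue_mapPath_comp_inv _ s r).trans ?_
  refine (congrArg (fun z => loopValue χ (z ≫ Groupoid.inv r)) hs').trans ?_
  refine congrArg (loopValue χ) (a₂ := FundamentalGroup.toArrow g) ?_
  rw [Category.assoc, Groupoid.comp_inv, Category.comp_id]

end Cover

/-! ### Elements of coproducts of modules -/

section Coproduct

variable {k : Type v} [Field k] {ι : Type u} (Z : ι → ModuleCat.{max u v} k)

open Classical in
/-- A coproduct of modules is a direct sum. -/
def coprodEquiv : (∐ Z : ModuleCat.{max u v} k) ≃ₗ[k] DirectSum ι fun i => Z i :=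
  (ModuleCat.coprodIsoDirectSum.{v, u, v} Z).toLinearEquiv

open Classical in
theorem coprodEquiv_ι (i : ι) (x : Z i) :
    coprodEquiv Z (Sigma.ι Z i x) = DirectSum.lof k ι (fun i => Z i) i x :=
  congrArg (fun f => f.hom x) (ModuleCat.ι_coprodIsoDirectSum_hom.{v, u, v} Z i)

open Classical in
/-- The linear map out of a coproduct defined by linear maps to a module in any universe. -/
def coprodDesc {N : Type*} [AddCommGroup N] [Module k N] (g : ∀ i, Z i →ₗ[k] N) :
    (∐ Z : ModuleCat.{max u v} k) →ₗ[k] N :=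
  DirectSum.toModule k ι N g ∘ₗ (coprodEquiv Z).toLinearMap

@[simp]
theorem coprodDesc_ι {N : Type*} [AddCommGroup N] [Module k N] (g : ∀ i, Z i →ₗ[k] N) (i : ι)
    (x : Z i) : coprodDesc Z g (Sigma.ι Z i x) = g i x := by
  classical
  rw [coprodDesc, LinearMap.comp_apply, LinearEquiv.coe_coe, coprodEquiv_ι,
    DirectSum.toModule_lof]

variable {Z} in
theorem coprod_linearMap_ext {N : Type*} [AddCommGroup N] [Module k N]
    {f g : (∐ Z : ModuleCat.{max u v} k) →ₗ[k] N}
    (h : ∀ i x, f (Sigma.ι Z i x) = g (Sigma.ι Z i x)) : f = g := by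
  classical
  have : f ∘ₗ (coprodEquiv Z).symm.toLinearMap = g ∘ₗ (coprodEquiv Z).symm.toLinearMap := by
    refine DirectSum.linearMap_ext _ fun i => LinearMap.ext fun x => ?_
    simp only [LinearMap.comp_apply, LinearEquiv.coe_coe, ← coprodEquiv_ι,
      LinearEquiv.symm_apply_apply, h]
  ext x
  simpa using LinearMap.congr_fun this (coprodEquiv Z x)

theorem mem_of_ι_mem (N : Submodule k (∐ Z : ModuleCat.{max u v} k))
    (h : ∀ i x, Sigma.ι Z i x ∈ N) (y : (∐ Z : ModuleCat.{max u v} k)) : y ∈ N := by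
  rw [← N.ker_mkQ, (coprod_linearMap_ext fun i x => ?_ : N.mkQ = 0)]
  · simp
  · simpa using h i x

open Classical in
/-- The projection of a coproduct of modules to one of its summands. -/
def coprodProj (i : ι) : (∐ Z : ModuleCat.{max u v} k) →ₗ[k] Z i :=
  DirectSum.component k ι (fun i => Z i) i ∘ₗ (coprodEquiv Z).toLinearMap

theorem coprodProj_ι_self (i : ι) (x : Z i) : coprodProj Z i (Sigma.ι Z i x) = x := by
  classical
  rw [coprodProj, LinearMap.comp_apply, LinearEquiv.coe_coe, coprodEquiv_ι,
    DirectSum.component.lof_self]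

theorem coprodProj_ι_of_ne {i j : ι} (h : j ≠ i) (x : Z j) :
    coprodProj Z i (Sigma.ι Z j x) = 0 := by
  classical
  rw [coprodProj, LinearMap.comp_apply, LinearEquiv.coe_coe, coprodEquiv_ι,
    DirectSum.component.of, dif_neg h]

theorem coprod_ext_proj {x y : (∐ Z : ModuleCat.{max u v} k)}
    (h : ∀ i, coprodProj Z i x = coprodProj Z i y) : x = y := by
  classical
  exact (coprodEquiv Z).injective (DFinsupp.ext h)

end Coproduct

/-! ### The chains of a regular abelian cover -/

section Fourier

open Opposite Simplicial

theorem hom_sum_zsmul_apply {k : Type v} [Field k] {M N : ModuleCat.{w} k} {ι : Type*} [Fintype ι]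
    (c : ι → ℤ) (f : ι → (M ⟶ N)) (x : M) :
    (∑ i, c i • f i).hom x = ∑ i, c i • (f i).hom x := by
  simp only [ModuleCat.hom_sum, ModuleCat.hom_zsmul, LinearMap.sum_apply, LinearMap.smul_apply]

theorem ι_localChains_d {C : Type*} [Category* C] [Preadditive C] {X : Type u} [TopologicalSpace X]
    [HasCoproducts.{u} C] (L : FundamentalGroupoid X ⥤ C) {n : ℕ} (σ : Simp X (op ⦋n + 1⦌)) :
    Sigma.ι (fun σ : Simp X (op ⦋n + 1⦌) => stalk L σ) σ ≫
      ((AlgebraicTopology.alternatingFaceMapComplex C).obj (localChains L)).d (n + 1) n =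
    ∑ i : Fin (n + 2), (-1 : ℤ) ^ i.val • (transport L (SimplexCategory.δ i).op σ ≫
      Sigma.ι (fun σ : Simp X (op ⦋n⦌) => stalk L σ)
        ((TopCat.toSSet.obj (TopCat.of X)).map (SimplexCategory.δ i).op σ)) := by
  rw [AlgebraicTopology.alternatingFaceMapComplex_obj_d,
    AlgebraicTopology.AlternatingFaceMapComplex.objD]
  refine (Preadditive.comp_sum _ _ _).trans (Finset.sum_congr rfl fun i _ => ?_)
  refine (Preadditive.comp_zsmul _ _ _).trans (congrArg ((-1 : ℤ) ^ i.val • ·) ?_)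
  exact Sigma.ι_desc _ _

variable {X : Type u} {Y : Type w} [TopologicalSpace X] [TopologicalSpace Y]
  {A : Type*} [CommGroup A] {p : C(Y, X)} {y₀ : Y} {χ : FundamentalGroup X (p y₀) →* A}
  [PathConnectedSpace Y] {k : Type v} [Field k]

theorem comp_inv_comp_eqToHom {G : Type*} [Groupoid G] {x y z : G} (a : x ⟶ y) (r : x ⟶ z)
    (h : y = z) : a ≫ Groupoid.inv (r ≫ eqToHom h.symm) = (a ≫ eqToHom h) ≫ Groupoid.inv r := by
  subst h
  simp

/-- The value of the transport of a stalk element to an equal simplex. -/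
theorem exists_ι_eq {x₀ : X} {ρ : FundamentalGroup X x₀ →* kˣ} {n : SimplexCategoryᵒᵖ}
    {σ σ' : Simp X n} (h : σ' = σ)
    (f : charStalk ρ (FundamentalGroupoid.mk (simpMap σ' (vertexZero n.unop)))) :
    ∃ f' : charStalk ρ (FundamentalGroupoid.mk (simpMap σ (vertexZero n.unop))),
      Sigma.ι (fun σ : Simp X n => stalk (charLocalSystem ρ) σ) σ' f =
        Sigma.ι (fun σ : Simp X n => stalk (charLocalSystem ρ) σ) σ f' ∧
      ∀ r, f'.1 r = f.1 (r ≫ eqToHom (congrArg (fun σ =>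
        FundamentalGroupoid.mk (simpMap σ (vertexZero n.unop))) h.symm)) := by
  subst h
  exact ⟨f, rfl, fun r => by simp⟩

variable (p y₀ χ k) in
/-- The map from singular chains of a cover to the product of the chains with coefficients in
the local systems of the characters of the group of the cover. -/
def toLocalChains (n : SimplexCategoryᵒᵖ) :
    (∐ fun _ : Simp Y n => ModuleCat.of k (ULift.{w} k) : ModuleCat.{max w v} k) →ₗ[k]
      ∀ φ : A →* kˣ, (∐ fun σ : Simp X n => stalk (charLocalSystem (φ.comp χ)) σ :
        ModuleCat.{max u v} k) :=
  coprodDesc _ fun τ => LinearMap.pi fun φ =>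
    LinearMap.toSpanSingleton k _
      (Sigma.ι (fun σ : Simp X n => stalk (charLocalSystem (φ.comp χ)) σ) (pushSimp p τ)
        (fiberElement p y₀ χ φ (simpMap τ (vertexZero n.unop)))) ∘ₗ
    (ULift.moduleEquiv : ULift.{w} k ≃ₗ[k] k).toLinearMap

theorem toLocalChains_ι {n : SimplexCategoryᵒᵖ} (τ : Simp Y n) (c : ULift.{w} k) (φ : A →* kˣ) :
    toLocalChains p y₀ χ k n
      (Sigma.ι (fun _ : Simp Y n => ModuleCat.of k (ULift.{w} k)) τ c) φ =
    c.down • Sigma.ι (fun σ : Simp X n => stalk (charLocalSystem (φ.comp χ)) σ) (pushSimp p τ)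
      (fiberElement p y₀ χ φ (simpMap τ (vertexZero n.unop))) := by
  rw [toLocalChains, coprodDesc_ι]
  rfl

/-- Fourier inversion: a suitable sum over φ of functionals of the φ-components returns |A| times
the coefficient of any given simplex. -/
theorem IsRegularCover.toLocalChains_injective [Finite A] [IsAlgClosed k]
    (hp : IsRegularCover χ p y₀)
    (hk : (Nat.card A : k) ≠ 0) (n : SimplexCategoryᵒᵖ) :
    Function.Injective (toLocalChains p y₀ χ k n) := by
  classical
  have := Fintype.ofFinite A
  have := Fintype.ofFinite (A →* kˣ)
  rw [Nat.card_eq_fintype_card] at hk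
  -- The exponent divides |A|, so it is invertible and k contains the roots of unity required by
  -- `sum_characters`.
  have : NeZero (Monoid.exponent A : k) := ⟨fun h => hk (by
    obtain ⟨m, hm⟩ := Group.exponent_dvd_card (G := A)
    rw [hm, Nat.cast_mul, h, zero_mul])⟩
  -- Reads the coefficient at p ∘ τ along the path attached to τ itself, the choice for which τ has
  -- value 1.
  let ev (τ : Simp Y n) (φ : A →* kˣ) :
      (∐ fun σ : Simp X n => stalk (charLocalSystem (φ.comp χ)) σ :
        ModuleCat.{max u v} k) →ₗ[k] k :=
    (LinearMap.proj (pathClass p y₀ (simpMap τ (vertexZero n.unop))) ∘ₗ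
      Submodule.subtype (charStalk (φ.comp χ) _)) ∘ₗ
      coprodProj (fun σ : Simp X n => stalk (charLocalSystem (φ.comp χ)) σ) (pushSimp p τ)
  have key (τ : Simp Y n) : ∑ φ, ev τ φ ∘ₗ LinearMap.proj φ ∘ₗ toLocalChains p y₀ χ k n =
      (Fintype.card A : k) • ((ULift.moduleEquiv : ULift.{w} k ≃ₗ[k] k).toLinearMap ∘ₗ
        coprodProj (fun _ : Simp Y n => ModuleCat.of k (ULift.{w} k)) τ) := by
    refine coprod_linearMap_ext fun τ' c => ?_
    rw [LinearMap.sum_apply]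
    refine (Finset.sum_congr rfl fun φ _ => (congrArg (ev τ φ) (toLocalChains_ι τ' c φ)).trans
      ((ev τ φ).map_smul _ _)).trans ?_
    rw [← Finset.smul_sum]
    by_cases h : pushSimp p τ' = pushSimp p τ
    · let a : A := loopValue χ (pathClass p y₀ (simpMap τ' (vertexZero n.unop)) ≫
        Groupoid.inv (pathClass p y₀ (simpMap τ (vertexZero n.unop)) ≫
        eqToHom (congrArg (fun σ => FundamentalGroupoid.mk (simpMap σ (vertexZero n.unop))) h.symm)))
      have hev (φ : A →* kˣ) : ev τ φ
          (Sigma.ι (fun σ : Simp X n => stalk (charLocalSystem (φ.comp χ)) σ) (pushSimp p τ')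
            (fiberElement p y₀ χ φ (simpMap τ' (vertexZero n.unop)))) = (φ a : kˣ) := by
        obtain ⟨f, hf, hr⟩ := exists_ι_eq h
          (fiberElement p y₀ χ φ (simpMap τ' (vertexZero n.unop)))
        refine (congrArg (ev τ φ) hf).trans ?_
        refine (congrArg (fun z => z.1 (pathClass p y₀ (simpMap τ (vertexZero n.unop))))
          (coprodProj_ι_self (fun σ : Simp X n => stalk (charLocalSystem (φ.comp χ)) σ) _ f)).trans
          ?_
        exact hr _
      have ha : a = 1 ↔ τ' = τ := by
        refine ⟨fun h1 => hp.eq_of_loopValue_eq_one h.symm h1, fun h1 => ?_⟩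
        subst h1
        refine (congrArg (loopValue χ) (a₂ := 𝟙 _) ?_).trans (loopValue_id χ)
        exact (congrArg (fun z => _ ≫ Groupoid.inv z) (Category.comp_id _)).trans
          (Groupoid.comp_inv _)
      rw [Finset.sum_congr rfl fun φ _ => hev φ, sum_characters]
      by_cases h1 : τ' = τ
      · rw [if_pos (ha.mpr h1)]
        subst h1
        rw [LinearMap.smul_apply, LinearMap.comp_apply, coprodProj_ι_self]
        exact mul_comm _ _
      · rw [if_neg (ha.not.mpr h1), LinearMap.smul_apply, LinearMap.comp_apply,
          coprodProj_ι_of_ne _ h1]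
        simp
    · have h1 : τ' ≠ τ := fun h1 => h (h1 ▸ rfl)
      have hev (φ : A →* kˣ) : ev τ φ
          (Sigma.ι (fun σ : Simp X n => stalk (charLocalSystem (φ.comp χ)) σ) (pushSimp p τ')
            (fiberElement p y₀ χ φ (simpMap τ' (vertexZero n.unop)))) = 0 :=
        (congrArg (fun z => z.1 (pathClass p y₀ (simpMap τ (vertexZero n.unop))))
          (coprodProj_ι_of_ne (fun σ : Simp X n => stalk (charLocalSystem (φ.comp χ)) σ) h _))
      rw [Finset.sum_congr rfl fun φ _ => hev φ, LinearMap.smul_apply, LinearMap.comp_apply,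
        coprodProj_ι_of_ne _ h1]
      simp
  rw [injective_iff_map_eq_zero]
  intro c hc
  refine coprod_ext_proj _ fun τ => ?_
  have h := LinearMap.congr_fun (key τ) c
  rw [LinearMap.sum_apply] at h
  have h0 (φ : A →* kˣ) :
      (ev τ φ ∘ₗ LinearMap.proj φ ∘ₗ toLocalChains p y₀ χ k n) c = 0 := by
    rw [LinearMap.comp_apply, LinearMap.comp_apply, hc, map_zero, map_zero]
  rw [Finset.sum_congr rfl fun φ _ => h0 φ, Finset.sum_const_zero, LinearMap.smul_apply] at h
  rw [map_zero]
  exact ULift.ext _ _ ((mul_eq_zero.mp h.symm).resolve_left hk)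

/-- It suffices to reach one stalk element over one simplex in one φ-component; the φ-isotypic
combination of the lifts does so. -/
theorem IsRegularCover.toLocalChains_surjective [Finite A] [PathConnectedSpace X]
    (hp : IsRegularCover χ p y₀) (hχ : Function.Surjective χ)
    (hk : (Nat.card A : k) ≠ 0) (n : SimplexCategoryᵒᵖ) :
    Function.Surjective (toLocalChains p y₀ χ k n) := by
  classical
  have := Fintype.ofFinite A
  have := Fintype.ofFinite (A →* kˣ)
  rw [Nat.card_eq_fintype_card] at hk
  have key (φ : A →* kˣ) (x) :
      Pi.single φ x ∈ LinearMap.range (toLocalChains p y₀ χ k n) := by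
    refine mem_of_ι_mem _ (Submodule.comap (LinearMap.single k (fun φ : A →* kˣ =>
      (∐ fun σ : Simp X n => stalk (charLocalSystem (φ.comp χ)) σ : ModuleCat.{max u v} k)) φ)
      (LinearMap.range (toLocalChains p y₀ χ k n))) (fun σ f => ?_) x
    let r : FundamentalGroupoid.mk (p y₀) ⟶ .mk (simpMap σ (vertexZero n.unop)) :=
      Path.Homotopic.Quotient.mk (PathConnectedSpace.somePath _ _)
    choose τ hτ hr using hp.exists_loopValue_eq hχ σ r
    -- The coefficients of the idempotent of φ in k[A], scaled by the value of `f` at `r`.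
    let c (a : A) : k := ((φ a)⁻¹ : kˣ) * (charStalk (φ.comp χ) _).subtype f r *
      (Fintype.card A : k)⁻¹
    refine ⟨∑ a, Sigma.ι (fun _ : Simp Y n => ModuleCat.of k (ULift.{w} k)) (τ a)
      (ULift.up (c a)), ?_⟩
    rw [map_sum]
    funext ψ
    rw [Finset.sum_apply]
    have hf (a : A) : ∃ f' : charStalk (ψ.comp χ)
        (FundamentalGroupoid.mk (simpMap σ (vertexZero n.unop))),
        Sigma.ι (fun σ : Simp X n => stalk (charLocalSystem (ψ.comp χ)) σ) (pushSimp p (τ a))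
          (fiberElement p y₀ χ ψ (simpMap (τ a) (vertexZero n.unop))) =
        Sigma.ι (fun σ : Simp X n => stalk (charLocalSystem (ψ.comp χ)) σ) σ f' ∧
        f'.1 r = (ψ a : kˣ) := by
      obtain ⟨f', h1, h2⟩ := exists_ι_eq (hτ a)
        (fiberElement p y₀ χ ψ (simpMap (τ a) (vertexZero n.unop)))
      refine ⟨f', h1, (h2 r).trans ?_⟩
      refine congrArg (fun a => ((ψ a : kˣ) : k)) (Eq.trans ?_ (hr a))
      exact congrArg (loopValue χ) (comp_inv_comp_eqToHom _ _ _)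
    choose f' hf' hr' using hf
    let l : charStalk (ψ.comp χ) (FundamentalGroupoid.mk (simpMap σ (vertexZero n.unop))) →ₗ[k] _ :=
      (Sigma.ι (fun σ : Simp X n => stalk (charLocalSystem (ψ.comp χ)) σ) σ).hom
    have hl : ∑ a, toLocalChains p y₀ χ k n
        (Sigma.ι (fun _ : Simp Y n => ModuleCat.of k (ULift.{w} k)) (τ a) (ULift.up (c a))) ψ =
        l (∑ a, c a • f' a) := by
      rw [map_sum]
      refine Finset.sum_congr rfl fun a _ => ?_
      rw [map_smul]
      exact (toLocalChains_ι _ _ _).trans (congrArg (c a • ·) (hf' a))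
    -- Orthogonality annihilates every component ψ ≠ φ and leaves `f` at ψ = φ.
    have hv : (∑ a, c a • f' a).1 r =
        if ψ = φ then (charStalk (φ.comp χ) _).subtype f r else 0 := by
      have h1 : (∑ a, c a • f' a).1 r = ∑ a, c a * (ψ a : kˣ) := by
        rw [← Submodule.subtype_apply, map_sum, Finset.sum_apply]
        refine Finset.sum_congr rfl fun a _ => ?_
        rw [← hr' a]
        rfl
      have h2 (a : A) : c a * (ψ a : kˣ) = (charStalk (φ.comp χ) _).subtype f r *
          (Fintype.card A : k)⁻¹ * (((φ a)⁻¹ : kˣ) * (ψ a : kˣ)) := by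
        simp only [c]; ring
      rw [h1, Finset.sum_congr rfl fun a _ => h2 a, ← Finset.mul_sum, sum_inv_mul_characters]
      split_ifs
      · rw [mul_assoc, inv_mul_cancel₀ hk, mul_one]
      · rw [mul_zero]
    refine hl.trans ?_
    by_cases hψ : ψ = φ
    · subst hψ
      rw [if_pos rfl] at hv
      exact (congrArg l (charStalk_ext (f' := f) r hv)).trans
        (Pi.single_eq_same (M := fun φ : A →* kˣ => (∐ fun σ : Simp X n =>
          stalk (charLocalSystem (φ.comp χ)) σ : ModuleCat.{max u v} k)) ψ _).symm
    · rw [if_neg hψ] at hv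
      exact ((congrArg l (charStalk_ext (f' := 0) r hv)).trans l.map_zero).trans
        (Pi.single_eq_of_ne (M := fun φ : A →* kˣ => (∐ fun σ : Simp X n =>
          stalk (charLocalSystem (φ.comp χ)) σ : ModuleCat.{max u v} k)) hψ _).symm
  intro z
  change z ∈ LinearMap.range (toLocalChains p y₀ χ k n)
  rw [← Finset.univ_sum_single z]
  exact sum_mem fun φ _ => key φ _

theorem IsRegularCover.toLocalChains_d (hp : IsRegularCover χ p y₀) (n : ℕ)
    (c : ((TopCat.toSSet.obj (TopCat.of Y)).chainComplex (ModuleCat.of k (ULift.{w} k))).X (n + 1))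
    (φ : A →* kˣ) :
    toLocalChains p y₀ χ k (op ⦋n⦌) (((TopCat.toSSet.obj (TopCat.of Y)).chainComplex
      (ModuleCat.of k (ULift.{w} k))).d (n + 1) n c) φ =
    ((AlgebraicTopology.alternatingFaceMapComplex (ModuleCat.{max u v} k)).obj
      (localChains (charLocalSystem (φ.comp χ)))).d (n + 1) n
      (toLocalChains p y₀ χ k (op ⦋n + 1⦌) c φ) := by
  let D : (∐ fun _ : Simp Y (op ⦋n + 1⦌) => ModuleCat.of k (ULift.{w} k) :
      ModuleCat.{max w v} k) →ₗ[k] (∐ fun _ : Simp Y (op ⦋n⦌) => ModuleCat.of k (ULift.{w} k) :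
      ModuleCat.{max w v} k) :=
    (((TopCat.toSSet.obj (TopCat.of Y)).chainComplex (ModuleCat.of k (ULift.{w} k))).d (n + 1) n).hom
  let D' : (∐ fun σ : Simp X (op ⦋n + 1⦌) => stalk (charLocalSystem (φ.comp χ)) σ :
      ModuleCat.{max u v} k) →ₗ[k]
      (∐ fun σ : Simp X (op ⦋n⦌) => stalk (charLocalSystem (φ.comp χ)) σ :
      ModuleCat.{max u v} k) :=
    (((AlgebraicTopology.alternatingFaceMapComplex (ModuleCat.{max u v} k)).obj
    (localChains (charLocalSystem (φ.comp χ)))).d (n + 1) n).hom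
  let T (n : SimplexCategoryᵒᵖ) := LinearMap.proj φ ∘ₗ toLocalChains p y₀ χ k n
  have h : T (op ⦋n⦌) ∘ₗ D = D' ∘ₗ T (op ⦋n + 1⦌) := by
    refine coprod_linearMap_ext fun τ c => ?_
    have h1 : D (Sigma.ι (fun _ : Simp Y (op ⦋n + 1⦌) => ModuleCat.of k (ULift.{w} k)) τ c) =
        ∑ i : Fin (n + 2), (-1 : ℤ) ^ i.val •
          Sigma.ι (fun _ : Simp Y (op ⦋n⦌) => ModuleCat.of k (ULift.{w} k))
            ((TopCat.toSSet.obj (TopCat.of Y)).δ i τ) c := by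
      have := congrArg (fun f => f.hom c) (SSet.ιChainComplex_d
        (R := ModuleCat.of k (ULift.{w} k)) (X := TopCat.toSSet.obj (TopCat.of Y)) τ)
      exact this.trans (hom_sum_zsmul_apply _ _ _)
    have h2 (f : charStalk (φ.comp χ) (FundamentalGroupoid.mk
        (simpMap (pushSimp p τ) (vertexZero ⦋n + 1⦌)))) :
        D' (Sigma.ι (fun σ : Simp X (op ⦋n + 1⦌) => stalk (charLocalSystem (φ.comp χ)) σ)
          (pushSimp p τ) f) =
        ∑ i : Fin (n + 2), (-1 : ℤ) ^ i.val •
          Sigma.ι (fun σ : Simp X (op ⦋n⦌) => stalk (charLocalSystem (φ.comp χ)) σ)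
            ((TopCat.toSSet.obj (TopCat.of X)).map (SimplexCategory.δ i).op (pushSimp p τ))
            (transport (charLocalSystem (φ.comp χ)) (SimplexCategory.δ i).op (pushSimp p τ) f) := by
      refine (congrArg (fun g => g.hom f)
        (ι_localChains_d (charLocalSystem (φ.comp χ)) (pushSimp p τ))).trans ?_
      exact hom_sum_zsmul_apply _ _ _
    change T (op ⦋n⦌) (D _) = D' (T (op ⦋n + 1⦌) _)
    rw [h1, map_sum]
    refine Eq.trans ?_ (congrArg D' (toLocalChains_ι τ c φ)).symm
    refine Eq.trans ?_ (D'.map_smul _ _).symm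
    refine Eq.trans ?_ (congrArg (c.down • ·) (h2 _)).symm
    beta_reduce
    rw [Finset.smul_sum]
    refine Fintype.sum_congr _ _ fun i => ?_
    rw [map_zsmul, smul_comm]
    refine congrArg ((-1 : ℤ) ^ i.val • ·) ?_
    refine (toLocalChains_ι _ c φ).trans (congrArg (c.down • ·) ?_)
    -- Faces commute with `pushSimp` by definition, so only the coefficients need comparison, and
    -- these agree by flatness.
    exact congrArg (Sigma.ι (fun σ : Simp X (op ⦋n⦌) => stalk (charLocalSystem (φ.comp χ)) σ) _)
      (hp.transport_fiberElement φ (SimplexCategory.δ i).op τ).symm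
  exact LinearMap.congr_fun h c

end Fourier

end AbelianCover

end


/-! ### The dimension formula -/

theorem theoremA {X : Type*} [TopologicalSpace X] [T2Space X] [ConnectedSpace X]
    [Topology.CWComplex (Set.univ : Set X)]
    [Finite (Topology.CWComplex.cell (Set.univ : Set X) 0)]
    [Finite (Topology.CWComplex.cell (Set.univ : Set X) 1)]
    (x₀ : X) {A : Type*} [CommGroup A] [Finite A]
    (χ : FundamentalGroup X x₀ →* A) (hχ : Function.Surjective χ)
    {Y : Type*} [TopologicalSpace Y] (p : C(Y, X)) (y₀ : Y)
    (hp : AbelianCover.IsRegularCover χ p y₀)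
    (k : Type*) [Field k] [IsAlgClosed k] (hk : ¬ ringChar k ∣ Nat.card A) (q : ℕ) :
    Cardinal.toENat (Module.rank k (AbelianCover.singularHomology k Y q)) =
      ∑' s : ℕ, (Set.range (fun φ : A →* kˣ => φ.comp χ) ∩
        AbelianCover.charVariety X x₀ k q (s + 1)).encard := by
  obtain rfl := hp.base
  have := AbelianCover.locallyPathConnectedSpace_of_cwComplex X
  have := hp.isCoveringMap.isLocalHomeomorph.locallyPathConnectedSpace
  have := hp.connected
  have : PathConnectedSpace X := pathConnectedSpace_iff_connectedSpace.mpr inferInstance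
  have : PathConnectedSpace Y := pathConnectedSpace_iff_connectedSpace.mpr inferInstance
  have := Fintype.ofFinite (A →* kˣ)
  have hk' : (Nat.card A : k) ≠ 0 := fun h => hk ((ringChar.spec k _).mp h)
  -- Surjectivity of χ makes pullback of characters injective, so each φ is counted once.
  have hinj : Function.Injective fun φ : A →* kˣ => φ.comp χ := fun φ ψ h =>
    (MonoidHom.cancel_right hχ).mp h
  refine Eq.trans ?_ (AbelianCover.tsum_encard_range_inter hinj
    fun ρ => Module.rank k (AbelianCover.charHomology ρ q)).symm
  obtain ⟨e⟩ := AbelianCover.nonempty_homology_linearEquiv_pi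
    ((TopCat.toSSet.obj (TopCat.of Y)).chainComplex (ModuleCat.of k (ULift k)))
    (fun φ : A →* kˣ => (AlgebraicTopology.alternatingFaceMapComplex (ModuleCat k)).obj
      (AbelianCover.localChains (AbelianCover.charLocalSystem (φ.comp χ))))
    (fun n => LinearEquiv.ofBijective (AbelianCover.toLocalChains p y₀ χ k _)
      ⟨hp.toLocalChains_injective hk' _, hp.toLocalChains_surjective hχ hk' _⟩)
    (fun n c φ => hp.toLocalChains_d n c φ) q
  -- The ranks lie in different universes; `toENat` is insensitive to the lifts and identifies all
  -- infinite ranks with ∞.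
  have h := congrArg Cardinal.toENat e.lift_rank_eq
  rw [Cardinal.toENat_lift, Cardinal.toENat_lift, AbelianCover.toENat_rank_pi] at h
  exact h
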